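/- Let $m,N,n\ge 0$ be integers and let $J^\infty$ be the infinite jet space of the trivial bundle $\mathbb R^2\times\mathbb R^m\to\mathbb R^2$, with coordinates $x,y$ and $u^k_I$, where $k=1,\dots,m$ and $I=(a,b)\in\mathbb N_0^2$ stands for $a$ derivatives in $x$ and $b$ in $y$; write $|I|=a+b$. Let $\mathcal F$ be the ring of smooth real functions on $J^\infty$ depending on finitely many coordinates, with total derivatives $D_x=\partial_x+\sum_{k,I}u^k_{I,x}\,\partial/\partial u^k_I$, $D_y=\partial_y+\sum_{k,I}u^k_{I,y}\,\partial/\partial u^k_I$, and $D_I=D_x^aD_y^b$. Let $F^1,\dots,F^N\in\mathcal F$, let $\mathcal E\subset J^\infty$ be the set of common zeros of all $D_I(F^l)$, and let $\mathcal I(\mathcal E)\subset\mathcal F$ be the ideal generated by all $D_I(F^l)$. Assume the regularity condition: a function $f\in\mathcal F$ vanishes at every point of $\mathcal E$ if and only if $f\in\mathcal I(\mathcal E)$. Let $\mathfrak g\subset\mathfrak{gl}(n,\mathbb R)$ be a matrix Lie algebra, let $\mathcal F^{\mathfrak g}$ be the set of $n\times n$ matrices $M$ over $\mathcal F$ with $M(\theta)\in\mathfrak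 g$ for all $\theta\in J^\infty$, and let $\mathcal I^{\mathfrak g}(\mathcal E)$ be the set of those $M\in\mathcal F^{\mathfrak g}$ all of whose entries lie in $\mathcal I(\mathcal E)$. Write $M|_{\mathcal E}$ for the class of $M$ in $\mathcal F^{\mathfrak g}/\mathcal I^{\mathfrak g}(\mathcal E)$. Partial and total derivatives act on matrices entrywise, and $[\cdot,\cdot]$ is the matrix commutator. A $\mathfrak g$-valued zero-curvature representation (ZCR) for $\mathcal E$ is a pair $(A,B)|_{\mathcal E}=(A|_{\mathcal E},B|_{\mathcal E})$ with $A,B\in\mathcal F^{\mathfrak g}$ and $(D_yA-D_xB+[A,B])|_{\mathcal E}=0$. For $A,B\in\mathcal F^{\mathfrak g}$ put $\widehat D_x^{A}M=D_xM-[A,M]$, $\widehat D_y^{B}M=D_yM-[B,M]$, and for $k=1,\dots,m$ $$\widehat{\mathrm E}{}_k^{A,B}(M)=\sum_{I=(a,b)}(-1)^{a+b}\,(\widehat D_x^{A})^a(\widehat D_y^{B})^b\,\frac{\partial M}{\partial u^k_I}.$$ Then for every $\mathfrak g$-valued ZCR $(A,B)|_{\mathcal E}$ there exist $\widetilde A,\widetilde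 B\in\mathcal F^{\mathfrak g}$ with $\widetilde A|_{\mathcal E}=A|_{\mathcal E}$ and $\widetilde B|_{\mathcal E}=B|_{\mathcal E}$ such that $$\widehat{\mathrm E}{}_k^{\widetilde A,\widetilde B}\bigl(D_y\widetilde A-D_x\widetilde B+[\widetilde A,\widetilde B]\bigr)\big|_{\mathcal E}=0\qquad\text{for all }k=1,\dots,m.$$ -/

import Mathlib

open scoped ContDiff

attribute [local instance] LieRing.ofAssociativeRing

namespace ZCR

/-- Coordinates of the infinite jet space of the trivial bundle `ℝ² × ℝᵐ → ℝ²`: `inl 0` is `x`,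
`inl 1` is `y`, and `inr (k, a, b)` is `u^k_I`, where the symmetric multi-index `I` consists of
`a` symbols `x` and `b` symbols `y`. -/
abbrev Coord (m : ℕ) : Type := Fin 2 ⊕ (Fin m × ℕ × ℕ)

/-- The infinite jet space. -/
abbrev Jet (m : ℕ) : Type := Coord m → ℝ

/-- `f` is smooth and depends on finitely many jet coordinates only. -/
def IsDiffFun {m : ℕ} (f : Jet m → ℝ) : Prop :=
  ∃ (s : Finset (Coord m)) (g : (s → ℝ) → ℝ),
    ContDiff ℝ ∞ g ∧ ∀ θ : Jet m, f θ = g (fun c => θ c)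

theorem isDiffFun_const {m : ℕ} (r : ℝ) : IsDiffFun (fun _ : Jet m => r) :=
  ⟨∅, fun _ => r, contDiff_const, fun _ => rfl⟩

theorem isDiffFun_coord {m : ℕ} (c : Coord m) : IsDiffFun (fun θ : Jet m => θ c) :=
  ⟨{c}, fun v => v ⟨c, Finset.mem_singleton_self c⟩, contDiff_apply _ _ _, fun _ => rfl⟩

/-- Differential functions are closed under smooth binary operations. -/
theorem IsDiffFun.comp₂ {m : ℕ} {f₁ f₂ : Jet m → ℝ} (h₁ : IsDiffFun f₁) (h₂ : IsDiffFun f₂)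
    (op : ℝ → ℝ → ℝ)
    (hop : ∀ {E : Type} [NormedAddCommGroup E] [NormedSpace ℝ E] {p q : E → ℝ},
      ContDiff ℝ ∞ p → ContDiff ℝ ∞ q → ContDiff ℝ ∞ (fun v => op (p v) (q v))) :
    IsDiffFun (fun θ => op (f₁ θ) (f₂ θ)) := by
  obtain ⟨s, g, hg, hs⟩ := h₁
  obtain ⟨t, g', hg', ht⟩ := h₂
  refine ⟨s ∪ t, fun v => op
    (g fun c => v ⟨c.1, Finset.mem_union_left t c.2⟩)
    (g' fun c => v ⟨c.1, Finset.mem_union_right s c.2⟩), ?_, ?_⟩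
  · exact hop (hg.comp (contDiff_pi.2 fun c => contDiff_apply _ _ _))
      (hg'.comp (contDiff_pi.2 fun c => contDiff_apply _ _ _))
  · intro θ
    simp only [hs, ht]

/-- The ring `𝓕(π)` of differential functions on the jet space. -/
def DiffFun (m : ℕ) : Subalgebra ℝ (Jet m → ℝ) where
  carrier := {f | IsDiffFun f}
  mul_mem' h₁ h₂ := IsDiffFun.comp₂ h₁ h₂ (fun a b => a * b) (fun hp hq => hp.mul hq)
  add_mem' h₁ h₂ := IsDiffFun.comp₂ h₁ h₂ (fun a b => a + b) (fun hp hq => hp.add hq)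
  algebraMap_mem' r := isDiffFun_const r

/-- The partial derivative in the coordinate `c`, on arbitrary functions on the jet space. -/
noncomputable def partialDeriv {m : ℕ} (c : Coord m) (f : Jet m → ℝ) : Jet m → ℝ :=
  fun θ => deriv (fun t => f (Function.update θ c t)) (θ c)

theorem partialDeriv_eq_zero {m : ℕ} {c : Coord m} {f : Jet m → ℝ} {s : Finset (Coord m)}
    {g : (s → ℝ) → ℝ} (hf : ∀ θ : Jet m, f θ = g (fun i => θ i)) (hc : c ∉ s) :
    partialDeriv c f = 0 := by
  funext θ
  have h : (fun t => f (Function.update θ c t)) = fun _ => f θ := by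
    funext t
    rw [hf, hf]
    congr 1
    funext i
    exact Function.update_of_ne (fun h : (i : Coord m) = c => hc (by rw [← h]; exact i.2)) _ _
  simp [partialDeriv, h]

theorem partialDeriv_eq_fderiv {m : ℕ} {c : Coord m} {f : Jet m → ℝ} {s : Finset (Coord m)}
    {g : (s → ℝ) → ℝ} (hg : ContDiff ℝ ∞ g) (hf : ∀ θ : Jet m, f θ = g (fun i => θ i))
    (hc : c ∈ s) (θ : Jet m) :
    partialDeriv c f θ = fderiv ℝ g (fun i => θ i) (Pi.single ⟨c, hc⟩ 1) := by
  have h : (fun t => f (Function.update θ c t)) =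
      fun t => g (Function.update (fun i : s => θ i) ⟨c, hc⟩ t) := by
    funext t
    rw [hf]
    congr 1
    funext i
    by_cases hi : i = ⟨c, hc⟩
    · subst hi; simp
    · rw [Function.update_of_ne hi, Function.update_of_ne (fun h => hi (Subtype.ext h))]
  have hu : Function.update (fun i : s => θ i) ⟨c, hc⟩ (θ c) = fun i : s => θ i :=
    Function.update_eq_self (⟨c, hc⟩ : s) (fun i : s => θ i)
  have hd : HasFDerivAt g (fderiv ℝ g (fun i => θ i))
      (Function.update (fun i : s => θ i) ⟨c, hc⟩ (θ c)) := by
    rw [hu]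
    exact ((hg.differentiable (by simp)) _).hasFDerivAt
  rw [partialDeriv, h]
  exact (hd.comp_hasDerivAt (θ c) (hasDerivAt_update _ _ _)).deriv

theorem IsDiffFun.partialDeriv {m : ℕ} {f : Jet m → ℝ} (c : Coord m) (h : IsDiffFun f) :
    IsDiffFun (partialDeriv c f) := by
  obtain ⟨s, g, hg, hf⟩ := h
  by_cases hc : c ∈ s
  · refine ⟨s, fun v => fderiv ℝ g v (Pi.single ⟨c, hc⟩ 1), ?_, partialDeriv_eq_fderiv hg hf hc⟩
    exact (hg.fderiv_right (by simp)).clm_apply contDiff_const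
  · rw [partialDeriv_eq_zero hf hc]
    exact isDiffFun_const 0

/-- The partial derivative `∂/∂c` as an operator on `𝓕(π)`. -/
noncomputable def pd {m : ℕ} (c : Coord m) (f : DiffFun m) : DiffFun m :=
  ⟨partialDeriv c f.1, IsDiffFun.partialDeriv c f.2⟩

/-- A differential function has only finitely many nonzero partial derivatives, so that the
sums `∑ᶠ` over multi-indices below are finite sums. -/
theorem finite_pd_ne_zero {m : ℕ} (f : DiffFun m) : {c : Coord m | pd c f ≠ 0}.Finite := by
  obtain ⟨s, g, -, hf⟩ := f.2
  refine s.finite_toSet.subset fun c hc => ?_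
  by_contra h
  exact hc (Subtype.ext (partialDeriv_eq_zero hf h))

/-- A jet coordinate as a differential function. -/
def coord {m : ℕ} (c : Coord m) : DiffFun m := ⟨fun θ => θ c, isDiffFun_coord c⟩

/-- The total derivative `D_x = ∂/∂x + ∑ u^k_{I,x} ∂/∂u^k_I`. -/
noncomputable def Dx {m : ℕ} (f : DiffFun m) : DiffFun m :=
  pd (Sum.inl 0) f +
    ∑ᶠ p : Fin m × ℕ × ℕ, coord (Sum.inr (p.1, p.2.1 + 1, p.2.2)) * pd (Sum.inr p) f

/-- The total derivative `D_y = ∂/∂y + ∑ u^k_{I,y} ∂/∂u^k_I`. -/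
noncomputable def Dy {m : ℕ} (f : DiffFun m) : DiffFun m :=
  pd (Sum.inl 1) f +
    ∑ᶠ p : Fin m × ℕ × ℕ, coord (Sum.inr (p.1, p.2.1, p.2.2 + 1)) * pd (Sum.inr p) f

/-- `D_I = D_x^a D_y^b` for the multi-index `I = (a, b)`. -/
noncomputable def DI {m : ℕ} (I : ℕ × ℕ) (f : DiffFun m) : DiffFun m :=
  Dx^[I.1] (Dy^[I.2] f)

/-- The equation manifold `𝓔`: all points where the `F^l` and all their total derivatives
vanish. -/
def equationManifold {m N : ℕ} (F : Fin N → DiffFun m) : Set (Jet m) :=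
  {θ | ∀ (l : Fin N) (I : ℕ × ℕ), (DI I (F l)).1 θ = 0}

/-- The differential ideal `𝓘(𝓔)` generated by all total derivatives of the `F^l`. -/
noncomputable def diffIdeal {m N : ℕ} (F : Fin N → DiffFun m) : Ideal (DiffFun m) :=
  Ideal.span (Set.range fun p : Fin N × (ℕ × ℕ) => DI p.2 (F p.1))

/-- The regularity condition: a differential function vanishes at all points of `𝓔` if and only
if it is a combination `∑ h_l^I D_I(F^l)` with coefficients in `𝓕(π)`. -/
def IsRegular {m N : ℕ} (F : Fin N → DiffFun m) : Prop :=
  ∀ f : DiffFun m, (∀ θ ∈ equationManifold F, f.1 θ = 0) ↔ f ∈ diffIdeal F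

/-- Matrices of differential functions, that is, `gl(n)`-valued functions. -/
abbrev MatFun (m n : ℕ) : Type := Matrix (Fin n) (Fin n) (DiffFun m)

/-- The value of a matrix-valued function at a point of the jet space. -/
def MatFun.eval {m n : ℕ} (M : MatFun m n) (θ : Jet m) : Matrix (Fin n) (Fin n) ℝ :=
  Matrix.of fun i j => (M i j).1 θ

/-- The set `𝓕^𝔤(π)` of `𝔤`-valued functions. -/
def gFun (m : ℕ) {n : ℕ} (𝔤 : LieSubalgebra ℝ (Matrix (Fin n) (Fin n) ℝ)) : Set (MatFun m n) :=
  {M | ∀ θ : Jet m, M.eval θ ∈ 𝔤}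

/-- `𝓘^𝔤(𝓔)`: the `𝔤`-valued functions all of whose entries lie in `𝓘(𝓔)`. The class `M|_𝓔` is
`M + 𝓘^𝔤(𝓔)`; thus `M|_𝓔 = 0` means `M ∈ gIdeal F 𝔤`, and `M|_𝓔 = M'|_𝓔` means
`M - M' ∈ gIdeal F 𝔤`. -/
def gIdeal {m N n : ℕ} (F : Fin N → DiffFun m)
    (𝔤 : LieSubalgebra ℝ (Matrix (Fin n) (Fin n) ℝ)) : Set (MatFun m n) :=
  {M | M ∈ gFun m 𝔤 ∧ ∀ i j, M i j ∈ diffIdeal F}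

/-- The Maurer--Cartan expression `D_y A - D_x B + [A, B]`, where total derivatives act
entrywise and the bracket is the matrix commutator. -/
noncomputable def maurerCartan {m n : ℕ} (A B : MatFun m n) : MatFun m n :=
  A.map Dy - B.map Dx + (A * B - B * A)

/-- `(A, B)` represents a `𝔤`-valued zero-curvature representation `(A, B)|_𝓔` for `𝓔`. -/
def IsZCR {m N n : ℕ} (F : Fin N → DiffFun m)
    (𝔤 : LieSubalgebra ℝ (Matrix (Fin n) (Fin n) ℝ)) (A B : MatFun m n) : Prop :=
  A ∈ gFun m 𝔤 ∧ B ∈ gFun m 𝔤 ∧ maurerCartan A B ∈ gIdeal F 𝔤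

/-- `D̂_x^R = D_x - ad_R`. -/
noncomputable def DxHat {m n : ℕ} (R M : MatFun m n) : MatFun m n := M.map Dx - (R * M - M * R)

/-- `D̂_y^S = D_y - ad_S`. -/
noncomputable def DyHat {m n : ℕ} (S M : MatFun m n) : MatFun m n := M.map Dy - (S * M - M * S)

/-- The `k`-th component of the gauge-twisted Euler operator,
`∑_{I = (a, b)} (-1)^{a + b} (D̂_x^A)^a (D̂_y^B)^b ∘ ∂/∂u^k_I`. -/
noncomputable def eulerHat {m n : ℕ} (A B : MatFun m n) (k : Fin m) (M : MatFun m n) :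
    MatFun m n :=
  ∑ᶠ I : ℕ × ℕ, (-1 : ℤ) ^ (I.1 + I.2) •
    (DxHat A)^[I.1] ((DyHat B)^[I.2] (M.map (pd (Sum.inr (k, I)))))

end ZCR

namespace ZCR

/-! The given representatives already work: one may take `A' = A` and `B' = B`. Let `R` be the
Maurer--Cartan expression and `I = (a, b)`. Since `∂/∂u_I` commutes with `D_x` up to `∂/∂u_{I-x}`,
and with `D_y` up to `∂/∂u_{I-y}`, linearizing gives `∂_I R = D̂_y ∂_I A + ∂_{I-y} A - D̂_x ∂_I B -
∂_{I-x} B` (`map_pd_maurerCartan`). Under the alternating sum of `D̂_x^a D̂_y^b`, the `A`-terms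
telescope exactly in `b`. The `B`-terms would telescope in `a` if `D̂_x` commuted with `D̂_y^b`. But
`[D̂_x, D̂_y] = ad_R` (`DxHat_DyHat_sub`), the entries of `R` lie in the differential ideal, and
that ideal is stable under total derivatives; so the defect stays in the ideal
(`DxHat_iterate_DyHat_sub_mem`). Membership in `𝔤` survives because partial and total derivatives
are `ℝ`-linear and `𝔤` is closed under brackets. -/

/-! ### Partial derivatives of differential functions. -/

theorem IsDiffFun.differentiable_update {m : ℕ} {f : Jet m → ℝ} (h : IsDiffFun f) (c : Coord m)
    (θ : Jet m) : Differentiable ℝ (fun t => f (Function.update θ c t)) := by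
  obtain ⟨s, g, hg, hf⟩ := h
  simp only [hf]
  refine (hg.differentiable (by simp)).comp (differentiable_pi.2 fun i => ?_)
  by_cases hi : (i : Coord m) = c
  · simp only [hi, Function.update_self]; fun_prop
  · simp only [Function.update_of_ne hi]; fun_prop

variable {m : ℕ}

theorem pd_apply (c : Coord m) (f : DiffFun m) (θ : Jet m) :
    (pd c f).1 θ = deriv (fun t => f.1 (Function.update θ c t)) (θ c) := rfl

theorem pd_add (c : Coord m) (f g : DiffFun m) : pd c (f + g) = pd c f + pd c g := by
  refine Subtype.ext (funext fun θ => ?_)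
  exact deriv_fun_add (f.2.differentiable_update c θ _) (g.2.differentiable_update c θ _)

theorem pd_mul (c : Coord m) (f g : DiffFun m) :
    pd c (f * g) = pd c f * g + f * pd c g := by
  refine Subtype.ext (funext fun θ => ?_)
  have := deriv_fun_mul (f.2.differentiable_update c θ (θ c)) (g.2.differentiable_update c θ (θ c))
  simp only [Function.update_eq_self] at this
  exact this

theorem pd_smul (c : Coord m) (r : ℝ) (f : DiffFun m) : pd c (r • f) = r • pd c f := by
  refine Subtype.ext (funext fun θ => ?_)
  exact deriv_const_mul r (f.2.differentiable_update c θ (θ c))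

/-- The partial derivative as a linear map. -/
noncomputable def pdLin (c : Coord m) : DiffFun m →ₗ[ℝ] DiffFun m where
  toFun := pd c
  map_add' := pd_add c
  map_smul' := pd_smul c

theorem pd_zero (c : Coord m) : pd c (0 : DiffFun m) = 0 := (pdLin c).map_zero

theorem pd_sub (c : Coord m) (f g : DiffFun m) : pd c (f - g) = pd c f - pd c g :=
  (pdLin c).map_sub f g

theorem pd_sum {ι : Type*} (c : Coord m) (s : Finset ι) (f : ι → DiffFun m) :
    pd c (∑ i ∈ s, f i) = ∑ i ∈ s, pd c (f i) := map_sum (pdLin c) f s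

theorem pd_coord_self (c : Coord m) : pd c (coord c) = 1 := by
  refine Subtype.ext (funext fun θ => ?_)
  simp [pd_apply, coord]

theorem pd_coord_of_ne {c d : Coord m} (h : d ≠ c) : pd c (coord d) = 0 := by
  refine Subtype.ext (funext fun θ => ?_)
  simp [pd_apply, coord, h]

theorem pd_one (c : Coord m) : pd c (1 : DiffFun m) = 0 := by
  refine Subtype.ext (funext fun θ => ?_)
  simp [pd_apply]

/-- On a common finite set of coordinates this is the symmetry of the second derivative of a smooth
function. If one coordinate lies outside that set, both sides vanish. -/
theorem pd_comm (c d : Coord m) (f : DiffFun m) : pd c (pd d f) = pd d (pd c f) := by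
  obtain ⟨s, g, hg, hf⟩ := f.2
  have hz : ∀ {c' : Coord m}, c' ∉ s → pd c' f = 0 := fun h =>
    Subtype.ext (partialDeriv_eq_zero hf h)
  have hr : ∀ {c' : Coord m} (h : c' ∈ s) (θ : Jet m),
      (pd c' f).1 θ = (fun v => fderiv ℝ g v (Pi.single ⟨c', h⟩ 1)) (fun i : s => θ i) := fun h =>
    partialDeriv_eq_fderiv hg hf h
  have hs : ∀ {c' : Coord m} (h : c' ∈ s),
      ContDiff ℝ ∞ (fun v => fderiv ℝ g v (Pi.single ⟨c', h⟩ 1)) := fun h =>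
    (hg.fderiv_right (by simp)).clm_apply contDiff_const
  by_cases hc : c ∈ s
  · by_cases hd : d ∈ s
    · refine Subtype.ext (funext fun θ => ?_)
      have h1 := partialDeriv_eq_fderiv (hs hd) (hr hd) hc θ
      have h2 := partialDeriv_eq_fderiv (hs hc) (hr hc) hd θ
      have hdiff : DifferentiableAt ℝ (fderiv ℝ g) (fun i : s => θ i) :=
        ((hg.fderiv_right (m := ∞) (by simp)).differentiable (by simp)) _
      have hsymm : IsSymmSndFDerivAt ℝ g (fun i : s => θ i) :=
        hg.contDiffAt.isSymmSndFDerivAt (by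
          simpa using WithTop.coe_le_coe.2 (le_top : (2 : ℕ∞) ≤ ⊤))
      rw [fderiv_clm_apply hdiff (differentiableAt_const _)] at h1 h2
      simp at h1 h2
      exact h1.trans ((hsymm _ _).trans h2.symm)
    · rw [hz hd, pd_zero]
      exact (Subtype.ext (partialDeriv_eq_zero
        (g := fun v => fderiv ℝ g v (Pi.single ⟨c, hc⟩ 1)) (hr hc) hd)).symm
  · rw [hz hc, pd_zero]
    by_cases hd : d ∈ s
    · exact Subtype.ext (partialDeriv_eq_zero
        (g := fun v => fderiv ℝ g v (Pi.single ⟨d, hd⟩ 1)) (hr hd) hc)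
    · rw [hz hd, pd_zero]

/-! ### Derivations with arbitrary coefficients. -/

/-- A finite set of coordinates outside which all partial derivatives of `f` vanish. -/
noncomputable def pdSupport (f : DiffFun m) : Finset (Coord m) := (finite_pd_ne_zero f).toFinset

theorem pd_eq_zero_of_notMem {f : DiffFun m} {c : Coord m} (h : c ∉ pdSupport f) : pd c f = 0 := by
  simpa [pdSupport] using h

theorem pd_pd_eq_zero {f : DiffFun m} {c d : Coord m} (h : c ∉ pdSupport f) :
    pd c (pd d f) = 0 := by
  rw [pd_comm, pd_eq_zero_of_notMem h, pd_zero]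

/-- The derivation `∑_c X_c ∂/∂c` of the ring of differential functions. -/
noncomputable def vectorField (X : Coord m → DiffFun m) (f : DiffFun m) : DiffFun m :=
  ∑ᶠ c, X c * pd c f

theorem vectorField_eq_sum (X : Coord m → DiffFun m) {f : DiffFun m} {s : Finset (Coord m)}
    (h : ∀ c ∉ s, pd c f = 0) : vectorField X f = ∑ c ∈ s, X c * pd c f := by
  refine finsum_eq_sum_of_support_subset _ fun c hc => ?_
  by_contra hcs
  exact hc (by simp [h c hcs])

theorem vectorField_add (X : Coord m → DiffFun m) (f g : DiffFun m) :
    vectorField X (f + g) = vectorField X f + vectorField X g := by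
  classical
  have hf : ∀ c ∉ pdSupport f ∪ pdSupport g, pd c f = 0 := fun c hc =>
    pd_eq_zero_of_notMem fun h => hc (Finset.mem_union_left _ h)
  have hg : ∀ c ∉ pdSupport f ∪ pdSupport g, pd c g = 0 := fun c hc =>
    pd_eq_zero_of_notMem fun h => hc (Finset.mem_union_right _ h)
  rw [vectorField_eq_sum X hf, vectorField_eq_sum X hg,
    vectorField_eq_sum X (s := pdSupport f ∪ pdSupport g)
      (fun c hc => by rw [pd_add, hf c hc, hg c hc, add_zero]), ← Finset.sum_add_distrib]
  simp only [pd_add, mul_add]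

theorem vectorField_smul (X : Coord m → DiffFun m) (r : ℝ) (f : DiffFun m) :
    vectorField X (r • f) = r • vectorField X f := by
  have hf : ∀ c ∉ pdSupport f, pd c f = 0 := fun c hc => pd_eq_zero_of_notMem hc
  rw [vectorField_eq_sum X hf, vectorField_eq_sum X (s := pdSupport f)
    (fun c hc => by rw [pd_smul, hf c hc, smul_zero]), Finset.smul_sum]
  simp only [pd_smul, mul_smul_comm]

theorem vectorField_mul (X : Coord m → DiffFun m) (f g : DiffFun m) :
    vectorField X (f * g) = vectorField X f * g + f * vectorField X g := by
  classical
  have hf : ∀ c ∉ pdSupport f ∪ pdSupport g, pd c f = 0 := fun c hc =>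
    pd_eq_zero_of_notMem fun h => hc (Finset.mem_union_left _ h)
  have hg : ∀ c ∉ pdSupport f ∪ pdSupport g, pd c g = 0 := fun c hc =>
    pd_eq_zero_of_notMem fun h => hc (Finset.mem_union_right _ h)
  rw [vectorField_eq_sum X hf, vectorField_eq_sum X hg,
    vectorField_eq_sum X (s := pdSupport f ∪ pdSupport g)
      (fun c hc => by rw [pd_mul, hf c hc, hg c hc, zero_mul, mul_zero, add_zero]),
    Finset.sum_mul, Finset.mul_sum, ← Finset.sum_add_distrib]
  refine Finset.sum_congr rfl fun c _ => ?_
  rw [pd_mul]; ring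

theorem vectorField_zero (X : Coord m → DiffFun m) : vectorField X 0 = 0 := by
  simp [vectorField, pd_zero]

theorem vectorField_sum {ι : Type*} (X : Coord m → DiffFun m) (s : Finset ι)
    (f : ι → DiffFun m) : vectorField X (∑ i ∈ s, f i) = ∑ i ∈ s, vectorField X (f i) :=
  map_sum (AddMonoidHom.mk' (vectorField X) (vectorField_add X)) f s

theorem vectorField_coord (X : Coord m → DiffFun m) (c : Coord m) :
    vectorField X (coord c) = X c := by
  rw [vectorField_eq_sum X (s := {c}) (fun d hd => pd_coord_of_ne (by simpa [eq_comm] using hd))]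
  simp [pd_coord_self]

theorem vectorField_one (X : Coord m → DiffFun m) : vectorField X 1 = 0 := by
  simp [vectorField, pd_one]

theorem pd_vectorField (c : Coord m) (X : Coord m → DiffFun m) (f : DiffFun m) :
    pd c (vectorField X f) = vectorField (fun d => pd c (X d)) f + vectorField X (pd c f) := by
  have hf : ∀ c ∉ pdSupport f, pd c f = 0 := fun c hc => pd_eq_zero_of_notMem hc
  rw [vectorField_eq_sum _ hf, vectorField_eq_sum _ hf,
    vectorField_eq_sum X (s := pdSupport f) (fun d hd => pd_pd_eq_zero hd), pd_sum,
    ← Finset.sum_add_distrib]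
  exact Finset.sum_congr rfl fun d _ => by rw [pd_mul, pd_comm c d]

/-- The second-order terms agree by symmetry of mixed partials, so the commutator is again a
first-order derivation, determined by its values on coordinates. -/
theorem vectorField_comm {X Y : Coord m → DiffFun m}
    (h : ∀ c, vectorField X (Y c) = vectorField Y (X c)) (f : DiffFun m) :
    vectorField X (vectorField Y f) = vectorField Y (vectorField X f) := by
  have hf : ∀ c ∉ pdSupport f, pd c f = 0 := fun c hc => pd_eq_zero_of_notMem hc
  have key : ∀ X Y : Coord m → DiffFun m, vectorField X (vectorField Y f) =
      ∑ c ∈ pdSupport f, vectorField X (Y c) * pd c f +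
        ∑ c ∈ pdSupport f, ∑ d ∈ pdSupport f, Y c * (X d * pd d (pd c f)) := by
    intro X Y
    rw [vectorField_eq_sum Y hf, vectorField_sum, ← Finset.sum_add_distrib]
    refine Finset.sum_congr rfl fun c _ => ?_
    rw [vectorField_mul, vectorField_eq_sum X (f := pd c f) (s := pdSupport f)
      (fun d hd => pd_pd_eq_zero hd), Finset.mul_sum]
  rw [key, key, Finset.sum_comm]
  simp only [h]
  congr 1
  refine Finset.sum_congr rfl fun c _ => Finset.sum_congr rfl fun d _ => ?_
  rw [pd_comm c d]; ring

/-! ### Total derivatives and their commutators with partial derivatives. -/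

/-- The coefficients of the total derivative `D_x`. -/
def DxCoeff : Coord m → DiffFun m :=
  Sum.elim ![1, 0] fun p => coord (Sum.inr (p.1, p.2.1 + 1, p.2.2))

/-- The coefficients of the total derivative `D_y`. -/
def DyCoeff : Coord m → DiffFun m :=
  Sum.elim ![0, 1] fun p => coord (Sum.inr (p.1, p.2.1, p.2.2 + 1))

theorem vectorField_sumElim (v : Fin 2 → DiffFun m) (w : Fin m × ℕ × ℕ → DiffFun m)
    (f : DiffFun m) : vectorField (Sum.elim v w) f =
      v 0 * pd (Sum.inl 0) f + v 1 * pd (Sum.inl 1) f + ∑ᶠ p, w p * pd (Sum.inr p) f := by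
  classical
  have h : ∀ c ∉ (Finset.univ : Finset (Fin 2)).disjSum (pdSupport f).toRight, pd c f = 0 := by
    rintro (c | c) hc
    · simp at hc
    · exact pd_eq_zero_of_notMem (by simpa using hc)
  rw [vectorField_eq_sum _ h, Finset.sum_disjSum, Fin.sum_univ_two,
    finsum_eq_sum_of_support_subset (s := (pdSupport f).toRight)]
  · rfl
  · intro p hp
    by_contra hps
    exact hp (by simp [pd_eq_zero_of_notMem (f := f) (c := Sum.inr p) (by simpa using hps)])

theorem Dx_eq_vectorField (f : DiffFun m) : Dx f = vectorField DxCoeff f := by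
  simp [DxCoeff, vectorField_sumElim, Dx]

theorem Dy_eq_vectorField (f : DiffFun m) : Dy f = vectorField DyCoeff f := by
  simp [DyCoeff, vectorField_sumElim, Dy]

theorem Dx_comm_Dy (f : DiffFun m) : Dx (Dy f) = Dy (Dx f) := by
  simp only [Dx_eq_vectorField, Dy_eq_vectorField]
  refine vectorField_comm (fun c => ?_) f
  rcases c with c | p
  · fin_cases c <;> simp [DxCoeff, DyCoeff, vectorField_zero, vectorField_one]
  · simp [DxCoeff, DyCoeff, vectorField_coord]

theorem Dx_add (f g : DiffFun m) : Dx (f + g) = Dx f + Dx g := by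
  simp only [Dx_eq_vectorField, vectorField_add]

theorem Dy_add (f g : DiffFun m) : Dy (f + g) = Dy f + Dy g := by
  simp only [Dy_eq_vectorField, vectorField_add]

theorem Dx_mul (f g : DiffFun m) : Dx (f * g) = Dx f * g + f * Dx g := by
  simp only [Dx_eq_vectorField, vectorField_mul]

theorem Dy_mul (f g : DiffFun m) : Dy (f * g) = Dy f * g + f * Dy g := by
  simp only [Dy_eq_vectorField, vectorField_mul]

/-- The total derivative `D_x` as a linear map. -/
noncomputable def DxLin : DiffFun m →ₗ[ℝ] DiffFun m where
  toFun := Dx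
  map_add' := Dx_add
  map_smul' r f := by simp only [Dx_eq_vectorField, vectorField_smul, RingHom.id_apply]

/-- The total derivative `D_y` as a linear map. -/
noncomputable def DyLin : DiffFun m →ₗ[ℝ] DiffFun m where
  toFun := Dy
  map_add' := Dy_add
  map_smul' r f := by simp only [Dy_eq_vectorField, vectorField_smul, RingHom.id_apply]

theorem vectorField_single (c : Coord m) (X : Coord m → DiffFun m) (hX : ∀ d, d ≠ c → X d = 0)
    (f : DiffFun m) : vectorField X f = X c * pd c f :=
  finsum_eq_single _ c fun d hd => by simp [hX d hd]

theorem pd_Dx_zero (k : Fin m) (b : ℕ) (f : DiffFun m) :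
    pd (Sum.inr (k, 0, b)) (Dx f) = Dx (pd (Sum.inr (k, 0, b)) f) := by
  have h : (fun d => pd (Sum.inr (k, 0, b)) (DxCoeff d)) = fun _ => (0 : DiffFun m) := by
    funext d
    rcases d with d | p
    · fin_cases d <;> simp [DxCoeff, pd_zero, pd_one]
    · exact pd_coord_of_ne (by simp)
  rw [Dx_eq_vectorField, Dx_eq_vectorField, pd_vectorField, h]
  simp [vectorField]

/-- Among the coefficients of `D_x`, only that of `∂/∂u_{I-x}` depends on `u_I`, and it equals
`u_I`. For `a = 0` there is no such coefficient. -/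
theorem pd_Dx_succ (k : Fin m) (a b : ℕ) (f : DiffFun m) :
    pd (Sum.inr (k, a + 1, b)) (Dx f) =
      Dx (pd (Sum.inr (k, a + 1, b)) f) + pd (Sum.inr (k, a, b)) f := by
  rw [Dx_eq_vectorField, Dx_eq_vectorField, pd_vectorField,
    vectorField_single (Sum.inr (k, a, b)), add_comm]
  · simp [DxCoeff, pd_coord_self]
  · rintro (d | ⟨k', a', b'⟩) hd
    · fin_cases d <;> simp [DxCoeff, pd_zero, pd_one]
    · exact pd_coord_of_ne (by simpa using hd)

theorem pd_Dy_zero (k : Fin m) (a : ℕ) (f : DiffFun m) :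
    pd (Sum.inr (k, a, 0)) (Dy f) = Dy (pd (Sum.inr (k, a, 0)) f) := by
  have h : (fun d => pd (Sum.inr (k, a, 0)) (DyCoeff d)) = fun _ => (0 : DiffFun m) := by
    funext d
    rcases d with d | p
    · fin_cases d <;> simp [DyCoeff, pd_zero, pd_one]
    · exact pd_coord_of_ne (by simp)
  rw [Dy_eq_vectorField, Dy_eq_vectorField, pd_vectorField, h]
  simp [vectorField]

theorem pd_Dy_succ (k : Fin m) (a b : ℕ) (f : DiffFun m) :
    pd (Sum.inr (k, a, b + 1)) (Dy f) =
      Dy (pd (Sum.inr (k, a, b + 1)) f) + pd (Sum.inr (k, a, b)) f := by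
  rw [Dy_eq_vectorField, Dy_eq_vectorField, pd_vectorField,
    vectorField_single (Sum.inr (k, a, b)), add_comm]
  · simp [DyCoeff, pd_coord_self]
  · rintro (d | ⟨k', a', b'⟩) hd
    · fin_cases d <;> simp [DyCoeff, pd_zero, pd_one]
    · exact pd_coord_of_ne (by simpa using hd)

/-! ### Stability of the differential ideal. -/

theorem mem_diffIdeal_of_derivation {N : ℕ} {F : Fin N → DiffFun m}
    {D : DiffFun m → DiffFun m} (hadd : ∀ f g, D (f + g) = D f + D g)
    (hmul : ∀ f g, D (f * g) = D f * g + f * D g)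
    (hgen : ∀ l I, D (DI I (F l)) ∈ diffIdeal F) {f : DiffFun m} (hf : f ∈ diffIdeal F) :
    D f ∈ diffIdeal F := by
  induction hf using Submodule.span_induction with
  | mem x hx => obtain ⟨p, rfl⟩ := hx; exact hgen _ _
  | zero =>
    have h0 : D 0 = 0 := by simpa using hadd 0 0
    rw [h0]; exact zero_mem _
  | add x y _ _ hx hy => rw [hadd]; exact add_mem hx hy
  | smul a x hx ih =>
    rw [smul_eq_mul, hmul]
    exact add_mem (Ideal.mul_mem_left _ _ hx) (Ideal.mul_mem_left _ _ ih)

theorem Dx_mem_diffIdeal {N : ℕ} {F : Fin N → DiffFun m} {f : DiffFun m}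
    (hf : f ∈ diffIdeal F) : Dx f ∈ diffIdeal F :=
  mem_diffIdeal_of_derivation Dx_add Dx_mul (fun l I => Ideal.subset_span
    ⟨(l, (I.1 + 1, I.2)), Function.iterate_succ_apply' _ _ _⟩) hf

theorem Dy_mem_diffIdeal {N : ℕ} {F : Fin N → DiffFun m} {f : DiffFun m}
    (hf : f ∈ diffIdeal F) : Dy f ∈ diffIdeal F :=
  mem_diffIdeal_of_derivation Dy_add Dy_mul (fun l I => Ideal.subset_span
    ⟨(l, (I.1, I.2 + 1)), by
      change Dx^[I.1] (Dy^[I.2 + 1] (F l)) = Dy (Dx^[I.1] (Dy^[I.2] (F l)))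
      rw [Function.iterate_succ_apply']
      exact (Function.Commute.iterate_left (f := Dx) (g := Dy) Dx_comm_Dy _ _)⟩) hf

/-! ### Matrix calculus and twisted total derivatives. -/

variable {n : ℕ}

theorem map_mul_of_leibniz (D : DiffFun m →ₗ[ℝ] DiffFun m)
    (hD : ∀ f g, D (f * g) = D f * g + f * D g) (M P : MatFun m n) :
    (M * P).map D = M.map D * P + M * P.map D := by
  ext1 i j
  simp only [Matrix.map_apply, Matrix.mul_apply, Matrix.add_apply, map_sum, hD,
    Finset.sum_add_distrib]

theorem map_Dx_mul (M P : MatFun m n) : (M * P).map Dx = M.map Dx * P + M * P.map Dx :=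
  map_mul_of_leibniz DxLin Dx_mul M P

theorem map_Dy_mul (M P : MatFun m n) : (M * P).map Dy = M.map Dy * P + M * P.map Dy :=
  map_mul_of_leibniz DyLin Dy_mul M P

theorem map_pd_mul (c : Coord m) (M P : MatFun m n) :
    (M * P).map (pd c) = M.map (pd c) * P + M * P.map (pd c) :=
  map_mul_of_leibniz (pdLin c) (pd_mul c) M P

theorem map_Dx_add (M P : MatFun m n) : (M + P).map Dx = M.map Dx + P.map Dx :=
  Matrix.map_add Dx Dx_add M P

theorem map_Dy_add (M P : MatFun m n) : (M + P).map Dy = M.map Dy + P.map Dy :=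
  Matrix.map_add Dy Dy_add M P

theorem map_pd_add (c : Coord m) (M P : MatFun m n) :
    (M + P).map (pd c) = M.map (pd c) + P.map (pd c) :=
  Matrix.map_add (pd c) (pd_add c) M P

theorem map_Dx_sub (M P : MatFun m n) : (M - P).map Dx = M.map Dx - P.map Dx :=
  Matrix.map_sub Dx DxLin.map_sub M P

theorem map_Dy_sub (M P : MatFun m n) : (M - P).map Dy = M.map Dy - P.map Dy :=
  Matrix.map_sub Dy DyLin.map_sub M P

theorem map_pd_sub (c : Coord m) (M P : MatFun m n) :
    (M - P).map (pd c) = M.map (pd c) - P.map (pd c) :=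
  Matrix.map_sub (pd c) (pd_sub c) M P

theorem map_Dx_map_Dy (M : MatFun m n) : (M.map Dy).map Dx = (M.map Dx).map Dy := by
  ext1 i j
  exact Dx_comm_Dy _

/-- `D̂_x^R` as an additive map. -/
noncomputable def DxHatHom (R : MatFun m n) : MatFun m n →+ MatFun m n :=
  AddMonoidHom.mk' (DxHat R) fun M P => by
    simp only [DxHat, map_Dx_add, mul_add, add_mul]; abel

/-- `D̂_y^S` as an additive map. -/
noncomputable def DyHatHom (S : MatFun m n) : MatFun m n →+ MatFun m n :=
  AddMonoidHom.mk' (DyHat S) fun M P => by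
    simp only [DyHat, map_Dy_add, mul_add, add_mul]; abel

/-- The operator `(D̂_x^A)^a (D̂_y^B)^b` as an additive map. -/
noncomputable def hatIter (A B : MatFun m n) (a b : ℕ) : MatFun m n →+ MatFun m n :=
  AddMonoidHom.mk' (fun M => (DxHat A)^[a] ((DyHat B)^[b] M)) fun M P => by
    have hx := iterate_map_add (DxHatHom A) a
    have hy := iterate_map_add (DyHatHom B) b
    exact (congrArg _ (hy M P)).trans (hx _ _)

/-- The curvature identity: the twisted derivatives commute up to the adjoint action of the
Maurer--Cartan expression. -/
theorem DxHat_DyHat_sub (A B M : MatFun m n) :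
    DxHat A (DyHat B M) - DyHat B (DxHat A M) = maurerCartan A B * M - M * maurerCartan A B := by
  simp only [DxHat, DyHat, maurerCartan, map_Dx_sub, map_Dy_sub, map_Dx_mul, map_Dy_mul,
    map_Dx_map_Dy]
  simp only [mul_sub, sub_mul, mul_add, add_mul, mul_assoc]
  abel

/-- `∂M/∂u^k_{I-x}` for the multi-index `I = (a, b)`, understood as zero when `a = 0`. -/
noncomputable def pdPredX (k : Fin m) : ℕ → ℕ → MatFun m n → MatFun m n
  | 0, _, _ => 0
  | a + 1, b, M => M.map (pd (Sum.inr (k, a, b)))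

/-- `∂M/∂u^k_{I-y}` for the multi-index `I = (a, b)`, understood as zero when `b = 0`. -/
noncomputable def pdPredY (k : Fin m) : ℕ → ℕ → MatFun m n → MatFun m n
  | _, 0, _ => 0
  | a, b + 1, M => M.map (pd (Sum.inr (k, a, b)))

theorem map_pd_map_Dx (k : Fin m) (a b : ℕ) (M : MatFun m n) :
    (M.map Dx).map (pd (Sum.inr (k, a, b))) =
      (M.map (pd (Sum.inr (k, a, b)))).map Dx + pdPredX k a b M := by
  ext1 i j
  cases a with
  | zero => exact (pd_Dx_zero k b _).trans (add_zero _).symm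
  | succ a => exact pd_Dx_succ k a b _

theorem map_pd_map_Dy (k : Fin m) (a b : ℕ) (M : MatFun m n) :
    (M.map Dy).map (pd (Sum.inr (k, a, b))) =
      (M.map (pd (Sum.inr (k, a, b)))).map Dy + pdPredY k a b M := by
  ext1 i j
  cases b with
  | zero => exact (pd_Dy_zero k a _).trans (add_zero _).symm
  | succ b => exact pd_Dy_succ k a b _

/-- By Leibniz, differentiating the bracket supplies exactly the adjoint terms that turn `D_y` and
`D_x` into twisted derivatives; the shifted terms come from the commutators of `∂/∂u_I` with total
derivatives. -/
theorem map_pd_maurerCartan (k : Fin m) (a b : ℕ) (A B : MatFun m n) :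
    (maurerCartan A B).map (pd (Sum.inr (k, a, b))) =
      DyHat B (A.map (pd (Sum.inr (k, a, b)))) + pdPredY k a b A -
        (DxHat A (B.map (pd (Sum.inr (k, a, b)))) + pdPredX k a b B) := by
  simp only [maurerCartan, DxHat, DyHat, map_pd_add, map_pd_sub, map_pd_mul, map_pd_map_Dx,
    map_pd_map_Dy]
  abel

/-! ### Computations modulo the differential ideal. -/

/-- The additive group of matrices with all entries in the differential ideal. -/
def matIdeal {N : ℕ} (F : Fin N → DiffFun m) (n : ℕ) : AddSubgroup (MatFun m n) where
  carrier := {M | ∀ i j, M i j ∈ diffIdeal F}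
  zero_mem' _ _ := zero_mem _
  add_mem' h h' i j := add_mem (h i j) (h' i j)
  neg_mem' h i j := neg_mem (h i j)

section Ideal

variable {N : ℕ} {F : Fin N → DiffFun m} {M : MatFun m n}

theorem mul_mem_matIdeal_left (P : MatFun m n) (h : M ∈ matIdeal F n) : P * M ∈ matIdeal F n :=
  fun i j => by
    rw [Matrix.mul_apply]
    exact sum_mem fun l _ => Ideal.mul_mem_left _ _ (h l j)

theorem mul_mem_matIdeal_right (P : MatFun m n) (h : M ∈ matIdeal F n) : M * P ∈ matIdeal F n :=
  fun i j => by
    rw [Matrix.mul_apply]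
    exact sum_mem fun l _ => Ideal.mul_mem_right _ _ (h i l)

theorem DxHat_mem_matIdeal (A : MatFun m n) (h : M ∈ matIdeal F n) : DxHat A M ∈ matIdeal F n :=
  sub_mem (fun i j => Dx_mem_diffIdeal (h i j))
    (sub_mem (mul_mem_matIdeal_left A h) (mul_mem_matIdeal_right A h))

theorem DyHat_mem_matIdeal (B : MatFun m n) (h : M ∈ matIdeal F n) : DyHat B M ∈ matIdeal F n :=
  sub_mem (fun i j => Dy_mem_diffIdeal (h i j))
    (sub_mem (mul_mem_matIdeal_left B h) (mul_mem_matIdeal_right B h))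

theorem iterate_DxHat_mem_matIdeal (A : MatFun m n) (a : ℕ) (h : M ∈ matIdeal F n) :
    (DxHat A)^[a] M ∈ matIdeal F n := by
  induction a with
  | zero => exact h
  | succ a ih => rw [Function.iterate_succ_apply']; exact DxHat_mem_matIdeal A ih

/-- Each transposition of `D̂_x` with one `D̂_y` costs a commutator with the curvature, which lies
in the ideal and stays there under further `D̂_y`. -/
theorem DxHat_iterate_DyHat_sub_mem {A B : MatFun m n} (h : maurerCartan A B ∈ matIdeal F n)
    (b : ℕ) (M : MatFun m n) :
    DxHat A ((DyHat B)^[b] M) - (DyHat B)^[b] (DxHat A M) ∈ matIdeal F n := by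
  induction b with
  | zero => simp
  | succ b ih =>
    have hy : ∀ P Q, DyHat B (P - Q) = DyHat B P - DyHat B Q := (DyHatHom B).map_sub
    have h1 := DyHat_mem_matIdeal B ih
    have h2 : DxHat A (DyHat B ((DyHat B)^[b] M)) - DyHat B (DxHat A ((DyHat B)^[b] M)) ∈
        matIdeal F n := by
      rw [DxHat_DyHat_sub]
      exact sub_mem (mul_mem_matIdeal_right _ h) (mul_mem_matIdeal_left _ h)
    rw [hy] at h1
    simpa only [Function.iterate_succ_apply', sub_add_sub_cancel] using add_mem h2 h1

end Ideal

/-! ### Finite order and telescoping. -/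

/-- The order of a jet coordinate plus one, and zero for the coordinates `x` and `y`. -/
def jetWeight : Coord m → ℕ := Sum.elim 0 fun p => p.2.1 + p.2.2 + 1

theorem exists_pd_eq_zero_of_le (k : Fin m) (M : MatFun m n) :
    ∃ K : ℕ, ∀ a b, K ≤ a + b → M.map (pd (Sum.inr (k, a, b))) = 0 := by
  -- The total weight dominates the weight of each coordinate occurring in any entry; the extra one
  -- in the weight makes every occurring order strictly smaller than the bound.
  refine ⟨∑ i, ∑ j, ∑ c ∈ pdSupport (M i j), jetWeight c,
    fun a b hab => ?_⟩
  ext1 i j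
  refine pd_eq_zero_of_notMem (f := M i j) fun hmem => ?_
  have h1 := Finset.single_le_sum (f := jetWeight)
    (fun _ _ => Nat.zero_le _) hmem
  have h2 := Finset.single_le_sum (f := fun j => ∑ c ∈ pdSupport (M i j),
    jetWeight c)
    (fun _ _ => Nat.zero_le _) (Finset.mem_univ j)
  have h3 := Finset.single_le_sum (f := fun i => ∑ j, ∑ c ∈ pdSupport (M i j),
    jetWeight c)
    (fun _ _ => Nat.zero_le _) (Finset.mem_univ i)
  have h4 : jetWeight (Sum.inr (k, a, b)) = a + b + 1 := rfl
  omega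

theorem sum_range_sub_pred {G : Type*} [AddCommGroup G] (g p : ℕ → G) (h0 : p 0 = 0)
    (hs : ∀ i, p (i + 1) = g i) (K : ℕ) : ∑ i ∈ Finset.range (K + 1), (g i - p i) = g K := by
  induction K with
  | zero => simp [h0]
  | succ K ih => rw [Finset.sum_range_succ, ih, hs]; abel

/-- Outside the square `a, b ≤ K` the order exceeds `K`. A full square, rather than a triangle,
allows telescoping along rows and columns separately. -/
theorem eulerHat_eq_sum (A B M : MatFun m n) (k : Fin m) {K : ℕ}
    (hK : ∀ a b, K ≤ a + b → M.map (pd (Sum.inr (k, a, b))) = 0) :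
    eulerHat A B k M = ∑ a ∈ Finset.range (K + 1), ∑ b ∈ Finset.range (K + 1),
      (-1 : ℤ) ^ (a + b) • hatIter A B a b (M.map (pd (Sum.inr (k, a, b)))) := by
  rw [← Finset.sum_product' (f := fun a b =>
    (-1 : ℤ) ^ (a + b) • hatIter A B a b (M.map (pd (Sum.inr (k, a, b)))))]
  refine finsum_eq_sum_of_support_subset
    (fun I : ℕ × ℕ => (-1 : ℤ) ^ (I.1 + I.2) • hatIter A B I.1 I.2 (M.map (pd (Sum.inr (k, I)))))
    fun I hI => ?_
  by_contra h
  refine hI ?_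
  have hle : K ≤ I.1 + I.2 := by
    simp only [Finset.coe_product, Set.mem_prod, Finset.mem_coe, Finset.mem_range] at h
    omega
  have hz : M.map (pd (Sum.inr (k, I))) = 0 := hK I.1 I.2 hle
  simp only [hz, map_zero, smul_zero]

theorem eulerHat_maurerCartan_mem_matIdeal {N : ℕ} {F : Fin N → DiffFun m} {A B : MatFun m n}
    (h : maurerCartan A B ∈ matIdeal F n) (k : Fin m) :
    eulerHat A B k (maurerCartan A B) ∈ matIdeal F n := by
  obtain ⟨KA, hA⟩ := exists_pd_eq_zero_of_le k A
  obtain ⟨KB, hB⟩ := exists_pd_eq_zero_of_le k B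
  obtain ⟨KM, hM⟩ := exists_pd_eq_zero_of_le k (maurerCartan A B)
  set K := KA + KB + KM
  rw [eulerHat_eq_sum A B _ k (K := K) (fun a b hab => hM a b (by omega))]
  -- The signs are arranged so that `g' a (b + 1) = g a b` and `f' (a + 1) b = f a b`, while `g' a
  -- 0` and `f' 0 b` vanish. The term `e` records the failure of `D̂_x` to commute with `D̂_y^b`.
  set g : ℕ → ℕ → MatFun m n := fun a b =>
    (-1 : ℤ) ^ (a + b) • hatIter A B a (b + 1) (A.map (pd (Sum.inr (k, a, b)))) with hg
  set g' : ℕ → ℕ → MatFun m n := fun a b =>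
    -((-1 : ℤ) ^ (a + b) • hatIter A B a b (pdPredY k a b A)) with hg'
  set f : ℕ → ℕ → MatFun m n := fun a b =>
    (-1 : ℤ) ^ (a + b) • hatIter A B (a + 1) b (B.map (pd (Sum.inr (k, a, b)))) with hf
  set f' : ℕ → ℕ → MatFun m n := fun a b =>
    -((-1 : ℤ) ^ (a + b) • hatIter A B a b (pdPredX k a b B)) with hf'
  set e : ℕ → ℕ → MatFun m n := fun a b =>
    (-1 : ℤ) ^ (a + b) • (DxHat A)^[a] (DxHat A ((DyHat B)^[b] (B.map (pd (Sum.inr (k, a, b))))) -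
      (DyHat B)^[b] (DxHat A (B.map (pd (Sum.inr (k, a, b)))))) with he
  have hterm : ∀ a b, (-1 : ℤ) ^ (a + b) •
      hatIter A B a b ((maurerCartan A B).map (pd (Sum.inr (k, a, b)))) =
        (g a b - g' a b) - (f a b - f' a b) + e a b := by
    intro a b
    have hx : ∀ P Q, (DxHat A)^[a] (P - Q) = (DxHat A)^[a] P - (DxHat A)^[a] Q :=
      iterate_map_sub (DxHatHom A) a
    have h1 : ∀ P, hatIter A B a b (DyHat B P) = hatIter A B a (b + 1) P := fun P => rfl
    have h2 : ∀ P, hatIter A B (a + 1) b P = (DxHat A)^[a] (DxHat A ((DyHat B)^[b] P)) :=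
      fun P => rfl
    have h3 : ∀ P, hatIter A B a b (DxHat A P) = (DxHat A)^[a] ((DyHat B)^[b] (DxHat A P)) :=
      fun P => rfl
    simp only [hg, hg', hf, hf', he, map_pd_maurerCartan, map_sub, map_add, h1, h2, h3, hx,
      smul_sub, smul_add]
    abel
  have hgsum : ∑ a ∈ Finset.range (K + 1), ∑ b ∈ Finset.range (K + 1), (g a b - g' a b) = 0 := by
    refine Finset.sum_eq_zero fun a _ => ?_
    rw [sum_range_sub_pred (g a) (g' a)]
    -- The surviving boundary term involves a derivative of `A` of order at least `K ≥ KA`.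
    · simp only [hg, hA a K (by omega), map_zero, smul_zero]
    · simp only [hg', pdPredY, map_zero, smul_zero, neg_zero]
    · intro b
      simp only [hg', hg, pdPredY, ← add_assoc, pow_succ, mul_neg, mul_one, neg_smul, neg_neg]
  have hfsum : ∑ a ∈ Finset.range (K + 1), ∑ b ∈ Finset.range (K + 1), (f a b - f' a b) = 0 := by
    -- The `B`-terms telescope in `a`, so `a` becomes the inner index.
    rw [Finset.sum_comm]
    refine Finset.sum_eq_zero fun b _ => ?_
    rw [sum_range_sub_pred (fun a => f a b) (fun a => f' a b)]
    · simp only [hf, hB K b (by omega), map_zero, smul_zero]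
    · simp only [hf', pdPredX, map_zero, smul_zero, neg_zero]
    · intro a
      simp only [hf', hf, pdPredX, add_right_comm a 1 b, pow_succ, mul_neg, mul_one, neg_smul,
        neg_neg]
  simp only [hterm, Finset.sum_add_distrib, Finset.sum_sub_distrib] at hgsum hfsum ⊢
  rw [hgsum, hfsum, sub_zero, zero_add]
  exact sum_mem fun a _ => sum_mem fun b _ => zsmul_mem
    (iterate_DxHat_mem_matIdeal A a (DxHat_iterate_DyHat_sub_mem h b _)) _

/-! ### Functions with values in the Lie algebra. -/

section LieAlgebra

variable {𝔤 : LieSubalgebra ℝ (Matrix (Fin n) (Fin n) ℝ)}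

/-- A linear functional on matrices, extended to matrices of differential functions. -/
noncomputable def extendFunctional (φ : Matrix (Fin n) (Fin n) ℝ →ₗ[ℝ] ℝ) (M : MatFun m n) :
    DiffFun m :=
  ∑ i, ∑ j, φ (Matrix.single i j 1) • M i j

theorem extendFunctional_apply (φ : Matrix (Fin n) (Fin n) ℝ →ₗ[ℝ] ℝ) (M : MatFun m n)
    (θ : Jet m) : (extendFunctional φ M).1 θ = φ (M.eval θ) := by
  conv_rhs => rw [Matrix.matrix_eq_sum_single (M.eval θ)]
  simp only [map_sum, extendFunctional]
  have h : ∀ i j, Matrix.single i j (M.eval θ i j) = (M i j).1 θ • Matrix.single i j (1 : ℝ) := by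
    intro i j; simp [MatFun.eval]
  simp only [h, map_smul]
  simp [mul_comm]

/-- A subspace is cut out by the linear functionals vanishing on it. Such a functional kills `M`
identically and commutes with the `ℝ`-linear `D`, so it kills `M.map D` too. -/
theorem map_mem_gFun (D : DiffFun m →ₗ[ℝ] DiffFun m) {M : MatFun m n} (hM : M ∈ gFun m 𝔤) :
    M.map D ∈ gFun m 𝔤 := by
  intro θ
  by_contra hθ
  obtain ⟨φ, hφ, hker⟩ := Submodule.exists_le_ker_of_notMem (p := 𝔤.toSubmodule) hθ
  refine hφ ?_
  have h0 : extendFunctional φ M = 0 := Subtype.ext <| funext fun η => by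
    rw [extendFunctional_apply]; exact hker (hM η)
  have h1 : extendFunctional φ (M.map D) = D (extendFunctional φ M) := by
    simp only [extendFunctional, map_sum, map_smul, Matrix.map_apply]
  rw [← extendFunctional_apply, h1, h0, map_zero]
  rfl

/-- The additive group of `𝔤`-valued functions. -/
def gFunAddSubgroup (m : ℕ) (𝔤 : LieSubalgebra ℝ (Matrix (Fin n) (Fin n) ℝ)) :
    AddSubgroup (MatFun m n) where
  carrier := gFun m 𝔤
  zero_mem' _ := zero_mem 𝔤
  add_mem' h h' θ := add_mem (h θ) (h' θ)
  neg_mem' h θ := neg_mem (h θ)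

theorem commutator_mem_gFun {M P : MatFun m n} (hM : M ∈ gFun m 𝔤) (hP : P ∈ gFun m 𝔤) :
    M * P - P * M ∈ gFunAddSubgroup m 𝔤 := by
  intro θ
  have h : MatFun.eval (M * P - P * M) θ = ⁅M.eval θ, P.eval θ⁆ := by
    ext i j
    simp [MatFun.eval, Ring.lie_def, Matrix.mul_apply]
  rw [h]
  exact 𝔤.lie_mem (hM θ) (hP θ)

theorem DxHat_mem_gFun {A M : MatFun m n} (hA : A ∈ gFun m 𝔤) (hM : M ∈ gFun m 𝔤) :
    DxHat A M ∈ gFun m 𝔤 :=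
  (gFunAddSubgroup m 𝔤).sub_mem (map_mem_gFun DxLin hM) (commutator_mem_gFun hA hM)

theorem DyHat_mem_gFun {B M : MatFun m n} (hB : B ∈ gFun m 𝔤) (hM : M ∈ gFun m 𝔤) :
    DyHat B M ∈ gFun m 𝔤 :=
  (gFunAddSubgroup m 𝔤).sub_mem (map_mem_gFun DyLin hM) (commutator_mem_gFun hB hM)

theorem eulerHat_mem_gFun {A B M : MatFun m n} (hA : A ∈ gFun m 𝔤) (hB : B ∈ gFun m 𝔤)
    (hM : M ∈ gFun m 𝔤) (k : Fin m) : eulerHat A B k M ∈ gFun m 𝔤 := by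
  refine finsum_induction (· ∈ gFunAddSubgroup m 𝔤) (zero_mem _)
    (fun _ _ => add_mem) fun I => zsmul_mem ?_ _
  have hy : Set.MapsTo (DyHat B) (gFun m 𝔤) (gFun m 𝔤) := fun _ h => DyHat_mem_gFun hB h
  have hx : Set.MapsTo (DxHat A) (gFun m 𝔤) (gFun m 𝔤) := fun _ h => DxHat_mem_gFun hA h
  exact hx.iterate _ (hy.iterate _ (map_mem_gFun (pdLin _) hM))

end LieAlgebra

/-- The twisted Euler operator of a zero-curvature representation annihilates, on the equation,
the Maurer--Cartan expression of any of its representatives. -/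
theorem eulerHat_maurerCartan_mem_gIdeal {N : ℕ} {F : Fin N → DiffFun m}
    {𝔤 : LieSubalgebra ℝ (Matrix (Fin n) (Fin n) ℝ)} {A B : MatFun m n} (h : IsZCR F 𝔤 A B)
    (k : Fin m) : eulerHat A B k (maurerCartan A B) ∈ gIdeal F 𝔤 :=
  ⟨eulerHat_mem_gFun h.1 h.2.1 h.2.2.1 k, eulerHat_maurerCartan_mem_matIdeal h.2.2.2 k⟩

theorem zero_mem_gIdeal {N : ℕ} (F : Fin N → DiffFun m)
    (𝔤 : LieSubalgebra ℝ (Matrix (Fin n) (Fin n) ℝ)) : (0 : MatFun m n) ∈ gIdeal F 𝔤 :=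
  ⟨(gFunAddSubgroup m 𝔤).zero_mem, (matIdeal F n).zero_mem⟩

end ZCR

theorem corollary4p6 {m N n : ℕ} (F : Fin N → ZCR.DiffFun m) (hF : ZCR.IsRegular F)
    (𝔤 : LieSubalgebra ℝ (Matrix (Fin n) (Fin n) ℝ))
    (A B : ZCR.MatFun m n) (hAB : ZCR.IsZCR F 𝔤 A B) :
    ∃ A' B' : ZCR.MatFun m n,
      A' ∈ ZCR.gFun m 𝔤 ∧ B' ∈ ZCR.gFun m 𝔤 ∧
      A' - A ∈ ZCR.gIdeal F 𝔤 ∧ B' - B ∈ ZCR.gIdeal F 𝔤 ∧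
      ∀ k : Fin m,
        ZCR.eulerHat A' B' k (ZCR.maurerCartan A' B') ∈ ZCR.gIdeal F 𝔤 := by
  -- No correction of the representatives is needed.
  refine ⟨A, B, hAB.1, hAB.2.1, ?_, ?_, ZCR.eulerHat_maurerCartan_mem_gIdeal hAB⟩
  · rw [sub_self]; exact ZCR.zero_mem_gIdeal F 𝔤
  · rw [sub_self]; exact ZCR.zero_mem_gIdeal F 𝔤
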